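/- Let $G$ be a connected bipartite (finite, simple) graph with $n\ge 3$ vertices, $m$ edges and $t$ spanning trees. Let $M_1(G)=\sum_{v} d(v)^2$ be its first Zagreb index (the sum of the squares of the vertex degrees), and let $LEE(G)=\sum_{i=1}^n e^{\mu_i}$ be its Laplacian Estrada index, where $\mu_1,\dots,\mu_n$ are the eigenvalues, with multiplicity, of the Laplacian matrix of $G$. Then \[ LEE(G)\ge 1+e^{2\sqrt{M_1(G)/n}}+(n-2)\,e^{\frac{2m-2\sqrt{M_1(G)/n}}{n-2}} \] and \[ LEE(G)\ge 1+e^{2\sqrt{M_1(G)/n}}+(n-2)\,e^{\left(\frac{tn\sqrt{n}}{2\sqrt{M_1(G)}}\right)^{\frac{1}{n-2}}}. \] In each of the two inequalities, equality holds if and only if $n$ is even and $G$ is (isomorphic to) the complete bipartite graph $K_{n/2,n/2}$. -/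

import Mathlib

namespace SimpleGraph

/-- The Laplacian Estrada index `LEE(G) = ∑ exp(μᵢ)`, where the `μᵢ` are the eigenvalues, counted
with multiplicity, of the Laplacian matrix of `G`. -/
noncomputable def laplacianEstradaIndex {V : Type*} [Fintype V] [DecidableEq V]
    (G : SimpleGraph V) [DecidableRel G.Adj] : ℝ :=
  ∑ i : V, Real.exp ((G.isHermitian_lapMatrix (R := ℝ)).eigenvalues i)

/-- The first Zagreb index `M₁(G)`: the sum of the squares of the vertex degrees. -/
def firstZagrebIndex {V : Type*} [Fintype V] (G : SimpleGraph V) [DecidableRel G.Adj] : ℕ :=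
  ∑ v : V, G.degree v ^ 2

/-- The number of spanning trees of `G`: the trees on the full vertex set of `G` all of whose
edges are edges of `G`. -/
noncomputable def numSpanningTrees {V : Type*} (G : SimpleGraph V) : ℕ :=
  {T : SimpleGraph V | T ≤ G ∧ T.IsTree}.ncard

end SimpleGraph

/-! Put `a = 2 * √(M₁ / n)`. If `ε` is the ±1 vector of a 2-colouring, then `L ε` has entries `2
d(v) ε(v)`, so `‖L ε‖² / ‖ε‖² = 4 M₁ / n = a²` and some Laplacian eigenvalue `x` is at least `a`.
Another eigenvalue is 0. The other `n - 2` eigenvalues and `x` together have sum `2m` (trace) and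
product `n t` (matrix tree theorem).

Choose `b` by `a + (n - 2) b = 2m` or by `a b ^ (n - 2) = n t`. Bound `exp` below at `a` and `b` by
tangents, linear in the variable or in its logarithm. The constraint merges all first-order terms
into `(e^a - e^b)(x - a)` or `(a e^a - b e^b)(log x - log a)`, which is nonnegative since `b ≤ a ≤
x`. Here `b ≤ a` comes from Cauchy–Schwarz on the degrees, with AM-GM added in the product case.

Equality forces the spectrum `0, a, b, …, b`. Then `ε` is an eigenvector for `a`, so `G` is
`k`-regular with `a = 2k`; the traces of `L` and `L²` give `b = k` and `n = 2k`, whence `G` is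
`K_{k,k}`. Conversely, the same traces determine the spectrum of `K_{k,k}`. -/

open Matrix

/-! ### Spectral identities for real symmetric matrices -/

namespace Matrix.IsHermitian

variable {ι : Type*} [Fintype ι] [DecidableEq ι] {A : Matrix ι ι ℝ} (hA : A.IsHermitian)

theorem exists_orthogonal_diagonalization :
    ∃ U : Matrix ι ι ℝ, Uᵀ * U = 1 ∧ U * Uᵀ = 1 ∧ A = U * diagonal hA.eigenvalues * Uᵀ := by
  refine ⟨hA.eigenvectorUnitary, ?_, ?_, ?_⟩
  · simpa [star_eq_conjTranspose] using Unitary.coe_star_mul_self hA.eigenvectorUnitary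
  · simpa [star_eq_conjTranspose] using Unitary.coe_mul_star_self hA.eigenvectorUnitary
  · conv_lhs => rw [hA.spectral_theorem, Unitary.conjStarAlgAut_apply]
    rfl

theorem trace_mul_self_eq_sum_eigenvalues_sq : (A * A).trace = ∑ i, hA.eigenvalues i ^ 2 := by
  obtain ⟨U, hU, -, h⟩ := hA.exists_orthogonal_diagonalization
  set D := diagonal hA.eigenvalues with hD
  calc (A * A).trace = (U * (D * (Uᵀ * U) * D * Uᵀ)).trace := by rw [h]; simp only [Matrix.mul_assoc]
    _ = (D * D * (Uᵀ * U)).trace := by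
      rw [trace_mul_comm, hU]; simp only [Matrix.mul_assoc, hU, Matrix.mul_one]
    _ = _ := by rw [hU, Matrix.mul_one, hD, diagonal_mul_diagonal, trace_diagonal]; simp [sq]

theorem trace_adjugate_eq_sum_prod_eigenvalues :
    A.adjugate.trace = ∑ i, ∏ j ∈ Finset.univ.erase i, hA.eigenvalues j := by
  obtain ⟨U, hU, -, h⟩ := hA.exists_orthogonal_diagonalization
  conv_lhs => rw [h]
  rw [adjugate_mul_distrib, adjugate_mul_distrib, trace_mul_comm, Matrix.mul_assoc,
    ← adjugate_mul_distrib, hU, adjugate_one, Matrix.mul_one, adjugate_diagonal, trace_diagonal]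

/-- Expansion of a vector in an orthonormal eigenbasis. -/
theorem exists_eigencoordinates (x : ι → ℝ) :
    ∃ y : ι → ℝ, x ⬝ᵥ x = ∑ i, y i ^ 2 ∧
      (A *ᵥ x) ⬝ᵥ (A *ᵥ x) = ∑ i, hA.eigenvalues i ^ 2 * y i ^ 2 ∧
      ∀ a, (∀ i, y i ≠ 0 → hA.eigenvalues i = a) → A *ᵥ x = a • x := by
  obtain ⟨U, hU, hU', h⟩ := hA.exists_orthogonal_diagonalization
  have norm_mulVec (z : ι → ℝ) : (U *ᵥ z) ⬝ᵥ (U *ᵥ z) = z ⬝ᵥ z := by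
    rw [dotProduct_mulVec, vecMul_mulVec, hU, vecMul_one]
  have hx : U *ᵥ (Uᵀ *ᵥ x) = x := by rw [mulVec_mulVec, hU', one_mulVec]
  have hAx : A *ᵥ x = U *ᵥ (diagonal hA.eigenvalues *ᵥ (Uᵀ *ᵥ x)) := by
    conv_lhs => rw [h]
    simp only [mulVec_mulVec, Matrix.mul_assoc]
  refine ⟨Uᵀ *ᵥ x, ?_, ?_, fun a ha ↦ ?_⟩
  · conv_lhs => rw [← hx]
    rw [norm_mulVec]; simp [dotProduct, sq]
  · rw [hAx, norm_mulVec]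
    simp only [dotProduct, mulVec_diagonal]
    exact Finset.sum_congr rfl fun i _ ↦ by ring
  · rw [hAx]
    have : diagonal hA.eigenvalues *ᵥ (Uᵀ *ᵥ x) = a • (Uᵀ *ᵥ x) := by
      ext i
      rw [mulVec_diagonal, Pi.smul_apply, smul_eq_mul]
      by_cases hi : (Uᵀ *ᵥ x) i = 0
      · simp [hi]
      · rw [ha i hi]
    rw [this, mulVec_smul, hx]

end Matrix.IsHermitian

/-! ### Rooted spanning trees as parent maps -/

namespace SimpleGraph

variable {V : Type*}

/-- `f` sends every vertex other than `r` to a neighbour, fixes `r`, and all its orbits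
reach `r`: it is the parent function of a spanning tree rooted at `r`. -/
structure IsParentMap (G : SimpleGraph V) (r : V) (f : V → V) : Prop where
  root : f r = r
  adj : ∀ u, u ≠ r → G.Adj u (f u)
  reach : ∀ u, ∃ k, f^[k] u = r

/-- The graph whose edges join each `u` to `f u`. -/
def parentGraph (f : V → V) : SimpleGraph V := fromRel fun u v ↦ f u = v

theorem exists_depth {r : V} {f : V → V} (reach : ∀ u, ∃ k, f^[k] u = r) :
    ∃ d : V → ℕ, ∀ u, u ≠ r → d (f u) < d u := by
  classical
  refine ⟨fun u ↦ Nat.find (reach u), fun u hu ↦ ?_⟩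
  have h := Nat.find_spec (reach u)
  rcases hk : Nat.find (reach u) with _ | k
  · rw [hk] at h; exact absurd h hu
  · rw [hk] at h
    change _ < Nat.find (reach u)
    rw [hk]
    exact Nat.lt_succ_of_le (Nat.find_min' (reach (f u)) h)

theorem parentGraph_adj {f : V → V} {u v : V} :
    (parentGraph f).Adj u v ↔ u ≠ v ∧ (f u = v ∨ f v = u) := Iff.rfl

namespace IsParentMap

variable {G : SimpleGraph V} {r : V} {f : V → V}

theorem parentGraph_le (hf : G.IsParentMap r f) : parentGraph f ≤ G := by
  intro u v h
  obtain ⟨hne, rfl | rfl⟩ := parentGraph_adj.1 h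
  · exact hf.adj u fun h ↦ hne (by rw [h, hf.root])
  · exact (hf.adj v fun h ↦ hne (by rw [h, hf.root])).symm

theorem parentGraph_connected (hf : G.IsParentMap r f) : (parentGraph f).Connected := by
  have h (k : ℕ) : ∀ u, f^[k] u = r → (parentGraph f).Reachable u r := by
    induction k with
    | zero => rintro u rfl; exact .refl _
    | succ k ih =>
      intro u hu
      rw [Function.iterate_succ_apply] at hu
      by_cases huf : u = f u
      · rw [huf]; exact ih _ hu
      · exact (Adj.reachable (parentGraph_adj.2 ⟨huf, .inl rfl⟩)).trans (ih _ hu)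
  have h' (u : V) : (parentGraph f).Reachable u r := (hf.reach u).elim fun k hk ↦ h k u hk
  exact (connected_iff _).2 ⟨fun u v ↦ (h' u).trans (h' v).symm, ⟨r⟩⟩

/-- Every edge is `s(u, f u)` for some `u ≠ r`, so there are at most `n - 1` edges, and a connected
graph with so few edges is a tree. -/
theorem parentGraph_isTree [Finite V] (hf : G.IsParentMap r f) : (parentGraph f).IsTree := by
  classical
  have := Fintype.ofFinite V
  have hc := hf.parentGraph_connected
  refine isTree_iff_connected_and_card.2 ⟨hc, le_antisymm ?_ hc.card_vert_le_card_edgeSet_add_one⟩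
  have hsub : (parentGraph f).edgeSet ⊆
      ((Finset.univ.erase r).image fun u ↦ s(u, f u) : Finset (Sym2 V)) := by
    intro e
    induction e with
    | h u v =>
      intro h
      obtain ⟨hne, rfl | rfl⟩ := parentGraph_adj.1 ((mem_edgeSet _).1 h)
      · simp only [Finset.coe_image, Set.mem_image]
        exact ⟨u, by simpa using fun h : u = r ↦ hne (by rw [h, hf.root]), rfl⟩
      · simp only [Finset.coe_image, Set.mem_image]
        exact ⟨v, by simpa using fun h : v = r ↦ hne (by rw [h, hf.root]), Sym2.eq_swap⟩
  have h1 := Set.ncard_le_ncard hsub (Finset.finite_toSet _)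
  rw [Set.ncard_coe_finset] at h1
  have h2 := Finset.card_image_le (s := Finset.univ.erase r) (f := fun u ↦ s(u, f u))
  rw [Finset.card_erase_of_mem (Finset.mem_univ r), Finset.card_univ] at h2
  have h3 : 0 < Fintype.card V := Fintype.card_pos_iff.2 ⟨r⟩
  rw [Nat.card_coe_set_eq, Nat.card_eq_fintype_card]
  omega

/-- Induct on the depth under `f`. The edge from `u` to `f u` can only disagree with `g` if `g (f u)
= u`; then `f (f u) = u` by induction, although depth strictly decreases along `f`. -/
theorem eq_of_parentGraph_eq {g : V → V} (hf : G.IsParentMap r f) (hg : G.IsParentMap r g)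
    (h : parentGraph f = parentGraph g) : f = g := by
  obtain ⟨d, hd⟩ := exists_depth hf.reach
  funext u
  induction hn : d u using Nat.strong_induction_on generalizing u with
  | _ n ih =>
    by_cases hu : u = r
    · rw [hu, hf.root, hg.root]
    have hne : u ≠ f u := (hf.adj u hu).ne
    have hadj : (parentGraph g).Adj u (f u) := h ▸ parentGraph_adj.2 ⟨hne, .inl rfl⟩
    obtain h1 | h1 := (parentGraph_adj.1 hadj).2
    · exact h1.symm
    · have hr : f u ≠ r := fun h2 ↦ hu (by rw [← h1, h2, hg.root])
      have h3 := ih _ (hn ▸ hd u hu) (f u) rfl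
      have h4 := hd _ hr
      rw [h3, h1] at h4
      exact absurd (hd u hu) h4.not_gt

end IsParentMap

/-- The parent of `u` is the next vertex on a shortest path to `r`. The resulting parent graph is
connected and lies in `T`, so it is `T` by minimality. -/
theorem IsTree.exists_isParentMap {G T : SimpleGraph V} (hT : T.IsTree) (hle : T ≤ G) (r : V) :
    ∃ f, G.IsParentMap r f ∧ parentGraph f = T := by
  have key (u : V) : ∃ v, (u = r → v = r) ∧ (u ≠ r → T.Adj u v ∧ T.dist v r < T.dist u r) := by
    by_cases hu : u = r
    · exact ⟨r, fun _ ↦ rfl, fun h ↦ absurd hu h⟩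
    · obtain ⟨p, hp⟩ := hT.connected.exists_walk_length_eq_dist u r
      cases p with
      | nil => exact absurd rfl hu
      | cons hadj q =>
        refine ⟨_, fun h ↦ absurd h hu, fun _ ↦ ⟨hadj, ?_⟩⟩
        rw [← hp, Walk.length_cons]
        exact Nat.lt_succ_of_le (dist_le q)
  choose f hf0 hf using key
  have hreach (u : V) : ∃ k, f^[k] u = r := by
    induction hn : T.dist u r using Nat.strong_induction_on generalizing u with
    | _ n ih =>
      by_cases hu : u = r
      · exact ⟨0, hu⟩
      · obtain ⟨k, hk⟩ := ih _ (hn ▸ (hf u hu).2) (f u) rfl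
        exact ⟨k + 1, hk⟩
  have hfT : T.IsParentMap r f := ⟨hf0 r rfl, fun u hu ↦ (hf u hu).1, hreach⟩
  exact ⟨f, ⟨hfT.root, fun u hu ↦ hle (hfT.adj u hu), hreach⟩, le_antisymm hfT.parentGraph_le
    ((isTree_iff_minimal_connected.1 hT).2 hfT.parentGraph_connected hfT.parentGraph_le)⟩

theorem ncard_isParentMap_eq_numSpanningTrees [Finite V] (G : SimpleGraph V) (r : V) :
    {f | G.IsParentMap r f}.ncard = G.numSpanningTrees := by
  refine Set.ncard_congr (fun f _ ↦ parentGraph f) (fun f hf ↦ ⟨hf.parentGraph_le,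
    hf.parentGraph_isTree⟩) (fun f g hf hg h ↦ hf.eq_of_parentGraph_eq hg h) ?_
  rintro T ⟨hle, hT⟩
  obtain ⟨f, hf, h⟩ := hT.exists_isParentMap hle r
  exact ⟨f, hf, h⟩

/-! ### The matrix tree theorem -/

section MatrixTree

variable [Fintype V] [DecidableEq V]

/-- The row at `u`, in the expansion of the rooted Laplacian, of the choice `v` for the image
of `u`. -/
def rootedRow (G : SimpleGraph V) [DecidableRel G.Adj] (r u v : V) : V → ℝ :=
  if u = r then (if v = r then Pi.single r 1 else 0)
  else if G.Adj u v then Pi.single u 1 - Pi.single v 1 else 0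

variable (G : SimpleGraph V) [DecidableRel G.Adj] (r : V)

/-- Away from the root, a Laplacian row is the sum of `e_u - e_v` over neighbours `v`.
Multilinearity of `det` then expands the cofactor over all maps `f : V → V`. -/
theorem updateRow_lapMatrix_eq_sum_rootedRow :
    (G.lapMatrix ℝ).updateRow r (Pi.single r 1) = fun u ↦ ∑ v, G.rootedRow r u v := by
  funext u
  by_cases hu : u = r
  · subst hu
    simp [rootedRow]
  · rw [updateRow_ne hu]
    ext w
    simp only [rootedRow, if_neg hu, Finset.sum_apply, apply_ite (fun g : V → ℝ ↦ g w),
      Pi.sub_apply, Pi.zero_apply]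
    rw [← Finset.sum_filter, Finset.sum_sub_distrib, Finset.sum_const, nsmul_eq_mul]
    rw [lapMatrix, degMatrix, Matrix.sub_apply, diagonal_apply, adjMatrix_apply,
      ← neighborFinset_eq_filter, card_neighborFinset_eq_degree]
    simp [Pi.single_apply, eq_comm]

variable {G r}

theorem det_rootedRow_of_isParentMap {f : V → V} (hf : G.IsParentMap r f) :
    det (fun u ↦ G.rootedRow r u (f u)) = 1 := by
  obtain ⟨d, hd⟩ := exists_depth hf.reach
  have hrow (u w : V) (hw : w ≠ u) (h : G.rootedRow r u (f u) w ≠ 0) : u ≠ r ∧ w = f u := by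
    by_cases hu : u = r
    · subst hu
      simp [rootedRow, hf.root, hw] at h
    · refine ⟨hu, ?_⟩
      by_contra hne
      simp [rootedRow, hu, hf.adj u hu, hw, hne] at h
  have hdiag (u : V) : G.rootedRow r u (f u) u = 1 := by
    by_cases hu : u = r
    · subst hu
      simp [rootedRow, hf.root]
    · simp [rootedRow, hu, hf.adj u hu, (hf.adj u hu).ne]
  -- Off the diagonal, row `u` can be nonzero only at `f u`, which has smaller depth; hence the
  -- matrix is block triangular with identity diagonal blocks.
  have htri : BlockTriangular (of fun u ↦ G.rootedRow r u (f u)) (OrderDual.toDual ∘ d) := by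
    intro u w huw
    by_contra h
    obtain ⟨hu, rfl⟩ := hrow u w (by rintro rfl; exact lt_irrefl _ huw) h
    exact lt_asymm (hd u hu) huw
  change det (of fun u ↦ G.rootedRow r u (f u)) = 1
  rw [htri.det]
  refine Finset.prod_eq_one fun k _ ↦ ?_
  refine (congrArg det ?_).trans det_one
  ext ⟨u, hu⟩ ⟨w, hw⟩
  rw [toSquareBlock_def]
  by_cases huw : w = u
  · subst huw
    simp [hdiag]
  · rw [one_apply_ne (by simpa [eq_comm] using huw)]
    by_contra h
    obtain ⟨hur, rfl⟩ := hrow u w huw h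
    have := hd u hur
    have h2 : d (f u) = d u := OrderDual.toDual.injective (hw.trans hu.symm)
    omega

theorem det_rootedRow_of_not_isParentMap {f : V → V} (hf : ¬ G.IsParentMap r f) :
    det (fun u ↦ G.rootedRow r u (f u)) = 0 := by
  classical
  by_cases h0 : f r = r
  swap
  · exact det_eq_zero_of_row_eq_zero r (by simp [rootedRow, h0])
  by_cases h1 : ∀ u, u ≠ r → G.Adj u (f u)
  swap
  · push Not at h1
    obtain ⟨u, hu, hadj⟩ := h1
    exact det_eq_zero_of_row_eq_zero u (by simp [rootedRow, hu, hadj])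
  have h2 : ¬ ∀ u, ∃ k, f^[k] u = r := fun h ↦ hf ⟨h0, h1, h⟩
  obtain ⟨u₀, hu₀⟩ := not_forall.1 h2
  -- The kernel vector is the indicator of the vertices whose orbit misses `r`. It takes equal
  -- values at `u` and `f u`, so each row `e_u - e_{f u}` kills it.
  refine exists_mulVec_eq_zero_iff.1 ⟨fun u ↦ if ∃ k, f^[k] u = r then 0 else 1, ?_, ?_⟩
  · exact fun h ↦ by simpa [hu₀] using congrFun h u₀
  · ext u
    change G.rootedRow r u (f u) ⬝ᵥ _ = 0
    by_cases hu : u = r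
    · subst hu
      have : ∃ k, f^[k] u = u := ⟨0, rfl⟩
      simp [rootedRow, h0, this]
    · have hiff : (∃ k, f^[k] (f u) = r) ↔ ∃ k, f^[k] u = r := by
        constructor
        · rintro ⟨k, hk⟩; exact ⟨k + 1, hk⟩
        · rintro ⟨_ | k, hk⟩
          · exact absurd hk hu
          · exact ⟨k, hk⟩
      simp [rootedRow, hu, h1 u hu, sub_dotProduct, hiff]

variable (G r)

/-- The **matrix tree theorem**: the diagonal cofactors of the Laplacian matrix count the
spanning trees. -/
theorem adjugate_lapMatrix_apply_self :
    (G.lapMatrix ℝ).adjugate r r = G.numSpanningTrees := by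
  classical
  rw [adjugate_apply, updateRow_lapMatrix_eq_sum_rootedRow]
  change (detRowAlternating (R := ℝ) (n := V)).toMultilinearMap _ = _
  rw [MultilinearMap.map_sum]
  change ∑ f : V → V, det (fun u ↦ G.rootedRow r u (f u)) = _
  have (f : V → V) : det (fun u ↦ G.rootedRow r u (f u)) = if G.IsParentMap r f then 1 else 0 := by
    split_ifs with hf
    exacts [det_rootedRow_of_isParentMap hf, det_rootedRow_of_not_isParentMap hf]
  simp_rw [this]
  rw [Finset.sum_boole, ← ncard_isParentMap_eq_numSpanningTrees G r,
    Set.ncard_eq_toFinset_card', Set.toFinset_ofPred]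

end MatrixTree

end SimpleGraph

/-! ### Exponential sums with prescribed sum or product -/

section ExpSums

open Real

theorem exp_add_mul_sub_lt_exp {x a : ℝ} (h : x ≠ a) : exp a + exp a * (x - a) < exp x := by
  have h1 := mul_lt_mul_of_pos_left (add_one_lt_exp (sub_ne_zero.2 h)) (exp_pos a)
  rw [← exp_add, add_sub_cancel] at h1
  linarith

/-- As a function of `log x`, `exp x` has slope `a * exp a` at `a`. The bound follows from the
ordinary tangent and `a * (log x - log a) ≤ x - a`. -/
theorem exp_add_mul_log_sub_lt_exp {x a : ℝ} (hx : 0 < x) (ha : 0 < a) (h : x ≠ a) :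
    exp a + a * exp a * (log x - log a) < exp x := by
  refine lt_of_le_of_lt ?_ (exp_add_mul_sub_lt_exp h)
  have h1 := log_le_sub_one_of_pos (div_pos hx ha)
  rw [log_div hx.ne' ha.ne', le_sub_iff_add_le, le_div_iff₀ ha] at h1
  nlinarith [exp_pos a]

variable {ι : Type*} {s : Finset ι} {y : ι → ℝ} {x a b : ℝ}

theorem exp_add_sum_exp_ge_of_tangent (p : ℝ) (q : ι → ℝ) (hp : x = a → p = 0)
    (hp' : x ≠ a → exp a + p < exp x) (hq : ∀ i ∈ s, y i = b → q i = 0)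
    (hq' : ∀ i ∈ s, y i ≠ b → exp b + q i < exp (y i)) (h : 0 ≤ p + ∑ i ∈ s, q i) :
    exp a + s.card * exp b ≤ exp x + ∑ i ∈ s, exp (y i) ∧
      (exp x + ∑ i ∈ s, exp (y i) = exp a + s.card * exp b → x = a ∧ ∀ i ∈ s, y i = b) := by
  have hsum : ∑ i ∈ s, (exp b + q i) = s.card * exp b + ∑ i ∈ s, q i := by
    rw [Finset.sum_add_distrib, Finset.sum_const, nsmul_eq_mul]
  have hx : exp a + p ≤ exp x := by
    by_cases hxa : x = a
    · rw [hp hxa, hxa, add_zero]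
    · exact (hp' hxa).le
  have hy : ∀ i ∈ s, exp b + q i ≤ exp (y i) := by
    intro i hi
    by_cases hyb : y i = b
    · rw [hq i hi hyb, hyb, add_zero]
    · exact (hq' i hi hyb).le
  have hy' := Finset.sum_le_sum hy
  refine ⟨by linarith, fun heq ↦ ⟨?_, fun i hi ↦ ?_⟩⟩
  · by_contra hxa
    linarith [hp' hxa]
  · by_contra hyb
    linarith [Finset.sum_lt_sum hy ⟨i, hi, hq' i hi hyb⟩]

theorem exp_add_sum_exp_ge_of_sum_eq (hab : b ≤ a) (hx : a ≤ x)
    (h : x + ∑ i ∈ s, y i = a + s.card * b) :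
    exp a + s.card * exp b ≤ exp x + ∑ i ∈ s, exp (y i) ∧
      (exp x + ∑ i ∈ s, exp (y i) = exp a + s.card * exp b → x = a ∧ ∀ i ∈ s, y i = b) := by
  refine exp_add_sum_exp_ge_of_tangent (exp a * (x - a)) (fun i ↦ exp b * (y i - b))
    (fun h ↦ by simp [h]) exp_add_mul_sub_lt_exp (fun i _ h ↦ by simp [h])
    (fun i _ ↦ exp_add_mul_sub_lt_exp) ?_
  rw [← Finset.mul_sum, Finset.sum_sub_distrib, Finset.sum_const, nsmul_eq_mul]
  have := mul_nonneg (sub_nonneg.2 (exp_le_exp.2 hab)) (sub_nonneg.2 hx)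
  have h' : ∑ i ∈ s, y i - s.card * b = -(x - a) := by linarith
  rw [h']
  linarith

theorem exp_add_sum_exp_ge_of_prod_eq (hb : 0 < b) (hab : b ≤ a) (hx : a ≤ x)
    (hy : ∀ i ∈ s, 0 < y i) (h : x * ∏ i ∈ s, y i = a * b ^ s.card) :
    exp a + s.card * exp b ≤ exp x + ∑ i ∈ s, exp (y i) ∧
      (exp x + ∑ i ∈ s, exp (y i) = exp a + s.card * exp b → x = a ∧ ∀ i ∈ s, y i = b) := by
  have ha := hb.trans_le hab
  have hx0 := ha.trans_le hx
  refine exp_add_sum_exp_ge_of_tangent (a * exp a * (log x - log a))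
    (fun i ↦ b * exp b * (log (y i) - log b))
    (fun h ↦ by simp [h]) (exp_add_mul_log_sub_lt_exp hx0 ha) (fun i _ h ↦ by simp [h])
    (fun i hi ↦ exp_add_mul_log_sub_lt_exp (hy i hi) hb) ?_
  have hlog := congrArg log h
  rw [log_mul hx0.ne' (Finset.prod_pos hy).ne', log_mul ha.ne' (pow_pos hb _).ne', log_pow,
    log_prod fun i hi ↦ (hy i hi).ne'] at hlog
  rw [← Finset.mul_sum, Finset.sum_sub_distrib, Finset.sum_const, nsmul_eq_mul]
  have := mul_nonneg (sub_nonneg.2 (mul_le_mul hab (exp_le_exp.2 hab) (exp_pos b).le ha.le))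
    (sub_nonneg.2 (log_le_log ha hx))
  have h' : ∑ i ∈ s, log (y i) - s.card * log b = -(log x - log a) := by linarith
  rw [h']
  linarith

/-- AM-GM, obtained by multiplying the inequalities `y i / a ≤ exp (y i / a - 1)`. -/
theorem prod_le_pow_card_of_sum_le (ha : 0 < a) (hy : ∀ i ∈ s, 0 ≤ y i)
    (h : ∑ i ∈ s, y i ≤ s.card * a) : ∏ i ∈ s, y i ≤ a ^ s.card := by
  rw [← div_le_one (pow_pos ha _), ← Finset.prod_const, ← Finset.prod_div_distrib]
  calc ∏ i ∈ s, y i / a ≤ ∏ i ∈ s, exp (y i / a - 1) :=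
        Finset.prod_le_prod (fun i hi ↦ div_nonneg (hy i hi) ha.le)
          fun i _ ↦ by linarith [add_one_le_exp (y i / a - 1)]
    _ = exp ((∑ i ∈ s, y i) / a - s.card) := by
        rw [← exp_sum, Finset.sum_sub_distrib, Finset.sum_div]; simp
    _ ≤ 1 := exp_le_one_iff.2 (by rw [sub_nonpos, div_le_iff₀ ha]; exact h)

end ExpSums

/-! ### Regular bipartite graphs and `K_{k,k}` -/

namespace SimpleGraph

variable {V : Type*}

section CompleteBipartite

/-- Neighbourhoods lie in the opposite colour class, so both classes have at least `k` elements,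
hence exactly `k`, and every neighbourhood fills the opposite class. -/
theorem exists_iso_completeBipartiteGraph_of_regular [Fintype V] [DecidableEq V]
    {G : SimpleGraph V} [DecidableRel G.Adj]
    (hbip : G.IsBipartite) {k : ℕ} (hcard : Fintype.card V = 2 * k)
    (hreg : G.IsRegularOfDegree k) : Nonempty (G ≃g completeBipartiteGraph (Fin k) (Fin k)) := by
  obtain ⟨c⟩ := hbip
  let cls (i : Fin 2) : Finset V := {v | c v = i}
  have hsub {i j : Fin 2} (hij : i ≠ j) {v : V} (hv : c v = i) :
      G.neighborFinset v ⊆ cls j := by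
    intro w hw
    have := c.valid ((mem_neighborFinset _ _ _).1 hw)
    simp only [cls, Finset.mem_filter_univ]
    omega
  have hle {i j : Fin 2} (hij : i ≠ j) {v : V} (hv : c v = i) : k ≤ (cls j).card := by
    rw [← hreg v, ← card_neighborFinset_eq_degree]
    exact Finset.card_le_card (hsub hij hv)
  have hcls (i j : Fin 2) (hij : i ≠ j) : (cls i).card + (cls j).card = 2 * k := by
    rw [← hcard, ← Finset.card_univ, ← Finset.card_filter_add_card_filter_not (s := Finset.univ) (fun v ↦ c v = i)]
    refine congrArg ((cls i).card + Finset.card ·) (Finset.ext fun v ↦ ?_)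
    simp only [cls, Finset.mem_filter_univ]
    omega
  have hge (j : Fin 2) : k ≤ (cls j).card := by
    obtain ⟨i, hij⟩ : ∃ i : Fin 2, i ≠ j := exists_ne j
    obtain hi | ⟨v, hv⟩ := (cls i).eq_empty_or_nonempty
    · have := hcls i j hij
      rw [hi] at this
      simp only [Finset.card_empty] at this
      omega
    · exact hle hij (by simpa [cls] using hv)
  have hcard (j : Fin 2) : (cls j).card = k := by
    obtain ⟨i, hij⟩ : ∃ i : Fin 2, i ≠ j := exists_ne j
    have := hcls i j hij
    have := hge i
    have := hge j
    omega
  have hadj (u v : V) : G.Adj u v ↔ c u ≠ c v := by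
    refine ⟨fun h ↦ c.valid h, fun h ↦ ?_⟩
    have := Finset.eq_of_subset_of_card_le (hsub h (v := u) rfl)
      (by rw [hcard, card_neighborFinset_eq_degree, hreg u])
    rw [← mem_neighborFinset, this]
    simp [cls]
  have e0 : {v // c v = 0} ≃ Fin k := Fintype.equivFinOfCardEq (by
    rw [Fintype.card_subtype]; exact hcard 0)
  have e1 : {v // ¬ c v = 0} ≃ Fin k := Fintype.equivFinOfCardEq (by
    rw [Fintype.card_subtype, ← hcard 1]
    refine congrArg Finset.card (Finset.ext fun v ↦ ?_)
    simp only [cls, Finset.mem_filter_univ]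
    omega)
  let e : V ≃ Fin k ⊕ Fin k := (Equiv.sumCompl fun v ↦ c v = 0).symm.trans (e0.sumCongr e1)
  refine ⟨⟨e, fun {u v} ↦ ?_⟩⟩
  rw [hadj]
  by_cases hu : c u = 0 <;> by_cases hv : c v = 0 <;>
    simp [e, hu, hv, Equiv.sumCompl_symm_apply_of_pos, Equiv.sumCompl_symm_apply_of_neg] <;> omega

theorem isRegularOfDegree_of_iso_completeBipartiteGraph [Fintype V] {G : SimpleGraph V}
    [DecidableRel G.Adj] {k : ℕ} (e : G ≃g completeBipartiteGraph (Fin k) (Fin k)) :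
    G.IsRegularOfDegree k := by
  classical
  intro v
  rw [← e.degree_eq v]
  rw [← card_neighborFinset_eq_degree]
  rcases e v with i | i
  · rw [show neighborFinset _ (Sum.inl i) = Finset.univ.map (.inr : Fin k ↪ Fin k ⊕ Fin k) by
      ext (j | j) <;> simp]
    simp
  · rw [show neighborFinset _ (Sum.inr i) = Finset.univ.map (.inl : Fin k ↪ Fin k ⊕ Fin k) by
      ext (j | j) <;> simp]
    simp

end CompleteBipartite

end SimpleGraph

/-! ### The Laplacian spectrum -/

namespace SimpleGraph

theorem Connected.numSpanningTrees_pos {V : Type*} [Finite V] {G : SimpleGraph V}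
    (h : G.Connected) : 0 < G.numSpanningTrees := by
  obtain ⟨T, hle, hT⟩ := h.exists_isTree_le
  exact (Set.ncard_pos (Set.toFinite _)).2 ⟨T, hle, hT⟩

section DegreeSums

variable {V : Type*} [Fintype V]

theorem sum_degree_cast (G : SimpleGraph V) [DecidableRel G.Adj] : ∑ v, (G.degree v : ℝ) = 2 * G.edgeFinset.card := by
  exact_mod_cast G.sum_degrees_eq_twice_card_edges

theorem firstZagrebIndex_of_regular {G : SimpleGraph V} [DecidableRel G.Adj] {k : ℕ}
    (hreg : G.IsRegularOfDegree k) :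
    (G.firstZagrebIndex : ℝ) = Fintype.card V * (k : ℝ) ^ 2 := by
  rw [firstZagrebIndex, Finset.sum_congr rfl fun v _ ↦ by rw [hreg v]]
  simp

theorem two_mul_card_edgeFinset_of_regular {G : SimpleGraph V} [DecidableRel G.Adj] {k : ℕ}
    (hreg : G.IsRegularOfDegree k) :
    (2 * G.edgeFinset.card : ℝ) = Fintype.card V * k := by
  rw [← sum_degree_cast, Finset.sum_congr rfl fun v _ ↦ by rw [hreg v]]
  simp

end DegreeSums

variable {V : Type*} [Fintype V] [DecidableEq V] (G : SimpleGraph V) [DecidableRel G.Adj]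

/-- The Laplacian eigenvalues of `G`, counted with multiplicity. -/
noncomputable abbrev lapEigenvalues : V → ℝ := (G.isHermitian_lapMatrix (R := ℝ)).eigenvalues

theorem lapEigenvalues_nonneg (i : V) : 0 ≤ G.lapEigenvalues i :=
  (G.posSemidef_lapMatrix ℝ).eigenvalues_nonneg i

theorem lapMatrix_apply_self (u : V) : G.lapMatrix ℝ u u = G.degree u := by
  rw [lapMatrix, degMatrix, Matrix.sub_apply, diagonal_apply_eq, adjMatrix_apply]
  simp

theorem sum_lapEigenvalues : ∑ i, G.lapEigenvalues i = 2 * G.edgeFinset.card := by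
  rw [← sum_degree_cast]
  exact (G.isHermitian_lapMatrix (R := ℝ)).trace_eq_sum_eigenvalues.symm.trans
    (Finset.sum_congr rfl fun u _ ↦ G.lapMatrix_apply_self u)

theorem sum_lapEigenvalues_sq :
    ∑ i, G.lapEigenvalues i ^ 2 = G.firstZagrebIndex + 2 * G.edgeFinset.card := by
  rw [← (G.isHermitian_lapMatrix (R := ℝ)).trace_mul_self_eq_sum_eigenvalues_sq,
    ← sum_degree_cast, firstZagrebIndex, Nat.cast_sum, ← Finset.sum_add_distrib]
  refine Finset.sum_congr rfl fun u _ ↦ ?_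
  rw [diag_apply, mul_apply, ← dotProduct, ← mulVec, lapMatrix_mulVec_apply,
    lapMatrix_apply_self, Nat.cast_pow, sq, sub_eq_add_neg, ← Finset.sum_neg_distrib]
  congr 1
  rw [← card_neighborFinset_eq_degree, Finset.card_eq_sum_ones, Nat.cast_sum]
  refine Finset.sum_congr rfl fun v hv ↦ ?_
  have h := (mem_neighborFinset _ _ _).1 hv
  rw [lapMatrix, degMatrix, Matrix.sub_apply, diagonal_apply_ne _ h.ne', adjMatrix_apply,
    if_pos h.symm]
  simp

theorem exists_lapEigenvalues_eq_zero [Nonempty V] : ∃ i, G.lapEigenvalues i = 0 := by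
  have h := (G.isHermitian_lapMatrix (R := ℝ)).det_eq_prod_eigenvalues
  rw [det_lapMatrix_eq_zero] at h
  simpa using Finset.prod_eq_zero_iff.1 h.symm

variable {G}

/-- **Kirchhoff's theorem**: deleting one zero eigenvalue, the Laplacian eigenvalues multiply to
the number of vertices times the number of spanning trees. -/
theorem prod_lapEigenvalues_erase {i₀ : V} (h₀ : G.lapEigenvalues i₀ = 0) :
    ∏ i ∈ Finset.univ.erase i₀, G.lapEigenvalues i = Fintype.card V * G.numSpanningTrees := by
  have h := (G.isHermitian_lapMatrix (R := ℝ)).trace_adjugate_eq_sum_prod_eigenvalues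
  rw [Finset.sum_eq_single i₀ (fun i _ hi ↦ Finset.prod_eq_zero
    (Finset.mem_erase.2 ⟨hi.symm, Finset.mem_univ _⟩) h₀) (by simp)] at h
  rw [← h, trace]
  simp_rw [diag_apply, adjugate_lapMatrix_apply_self]
  simp

/-- A second zero eigenvalue would make the product in Kirchhoff's theorem vanish, but a connected
graph has a spanning tree. -/
theorem Connected.lapEigenvalues_pos (h : G.Connected) {i₀ i : V}
    (h₀ : G.lapEigenvalues i₀ = 0) (hi : i ≠ i₀) : 0 < G.lapEigenvalues i := by
  refine (G.lapEigenvalues_nonneg i).lt_of_ne' fun h1 ↦ ?_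
  have h2 := prod_lapEigenvalues_erase h₀
  rw [Finset.prod_eq_zero (Finset.mem_erase.2 ⟨hi, Finset.mem_univ _⟩) h1] at h2
  have : Nonempty V := ⟨i⟩
  have h3 : (0 : ℝ) < Fintype.card V * G.numSpanningTrees :=
    mul_pos (Nat.cast_pos.2 Fintype.card_pos) (Nat.cast_pos.2 h.numSpanningTrees_pos)
  exact h3.ne h2

/-- The sign vector of a 2-colouring. -/
theorem IsBipartite.exists_sign (h : G.IsBipartite) :
    ∃ ε : V → ℝ, (∀ v, ε v * ε v = 1) ∧ ∀ u, (G.lapMatrix ℝ *ᵥ ε) u = 2 * G.degree u * ε u := by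
  obtain ⟨c⟩ := h
  refine ⟨fun v ↦ if c v = 0 then 1 else -1, fun v ↦ by dsimp only; split_ifs <;> norm_num, fun u ↦ ?_⟩
  rw [lapMatrix_mulVec_apply]
  have (v : V) (hv : v ∈ G.neighborFinset u) :
      (if c v = 0 then 1 else -1 : ℝ) = -(if c u = 0 then 1 else -1) := by
    have h := c.valid ((mem_neighborFinset _ _ _).1 hv)
    by_cases hu : c u = 0
    · have : c v ≠ 0 := by omega
      simp [hu, this]
    · have : c v = 0 := by omega
      simp [hu, this]
  rw [Finset.sum_congr rfl this, Finset.sum_const, nsmul_eq_mul, card_neighborFinset_eq_degree]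
  ring

/-- The Rayleigh quotient of the sign vector of a 2-colouring bounds the largest Laplacian
eigenvalue from below; if the bound is attained, the graph is regular. -/
theorem IsBipartite.exists_le_lapEigenvalues (h : G.IsBipartite) [Nonempty V] {a : ℝ}
    (ha : 0 ≤ a) (ha2 : a ^ 2 * Fintype.card V = 4 * G.firstZagrebIndex) :
    (∃ i, a ≤ G.lapEigenvalues i) ∧
      ((∀ i, G.lapEigenvalues i ≤ a) → ∀ v, 2 * (G.degree v : ℝ) = a) := by
  obtain ⟨ε, hε, hL⟩ := h.exists_sign
  obtain ⟨y, h1, h2, h3⟩ := (G.isHermitian_lapMatrix (R := ℝ)).exists_eigencoordinates ε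
  have hcard : ε ⬝ᵥ ε = Fintype.card V := by
    rw [dotProduct, Finset.sum_congr rfl fun v _ ↦ hε v]; simp
  have hnorm : (G.lapMatrix ℝ *ᵥ ε) ⬝ᵥ (G.lapMatrix ℝ *ᵥ ε) = 4 * G.firstZagrebIndex := by
    rw [dotProduct, firstZagrebIndex, Nat.cast_sum, Finset.mul_sum]
    refine Finset.sum_congr rfl fun v _ ↦ ?_
    rw [hL, Nat.cast_pow]
    linear_combination 4 * (G.degree v : ℝ) ^ 2 * hε v
  -- In eigencoordinates `y` of `ε`, this says `‖L ε‖² = a² ‖ε‖²`. If all eigenvalues are at most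
  -- `a`, every term vanishes and `ε` lies in the `a`-eigenspace.
  have hzero : ∑ i, (a ^ 2 - G.lapEigenvalues i ^ 2) * y i ^ 2 = 0 := by
    simp_rw [sub_mul]
    rw [Finset.sum_sub_distrib, ← Finset.mul_sum, ← h1, hcard, ha2, ← hnorm, h2, sub_self]
  constructor
  · by_contra! hlt
    have hpos : ∀ i, 0 < a ^ 2 - G.lapEigenvalues i ^ 2 := fun i ↦
      sub_pos.2 (pow_lt_pow_left₀ (hlt i) (G.lapEigenvalues_nonneg i) two_ne_zero)
    have hy : ∀ i, y i ^ 2 = 0 := fun i ↦ by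
      have := (Finset.sum_eq_zero_iff_of_nonneg
        fun i _ ↦ mul_nonneg (hpos i).le (sq_nonneg (y i))).1 hzero i (Finset.mem_univ i)
      exact (mul_eq_zero.1 this).resolve_left (hpos i).ne'
    rw [hcard, Finset.sum_eq_zero fun i _ ↦ hy i] at h1
    exact Fintype.card_ne_zero (Nat.cast_eq_zero.1 h1)
  · intro hle v
    have hnn : ∀ i, 0 ≤ a ^ 2 - G.lapEigenvalues i ^ 2 := fun i ↦
      sub_nonneg.2 (pow_le_pow_left₀ (G.lapEigenvalues_nonneg i) (hle i) 2)
    have hy : ∀ i, y i ≠ 0 → G.lapEigenvalues i = a := fun i hi ↦ by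
      have := (Finset.sum_eq_zero_iff_of_nonneg
        fun i _ ↦ mul_nonneg (hnn i) (sq_nonneg (y i))).1 hzero i (Finset.mem_univ i)
      have := (mul_eq_zero.1 this).resolve_right (pow_ne_zero 2 hi)
      exact (pow_left_inj₀ (G.lapEigenvalues_nonneg i) ha two_ne_zero).1 (sub_eq_zero.1 this).symm
    have hv := congrFun (h3 a hy) v
    rw [hL, Pi.smul_apply, smul_eq_mul] at hv
    exact mul_right_cancel₀ (fun h0 ↦ by simpa [h0] using hε v) hv

theorem sum_eq_add_add_sum_erase {i₀ i₁ : V} (h01 : i₁ ≠ i₀) (f : V → ℝ) :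
    ∑ i, f i = f i₀ + (f i₁ + ∑ i ∈ (Finset.univ.erase i₀).erase i₁, f i) := by
  rw [Finset.add_sum_erase _ _ (Finset.mem_erase.2 ⟨h01, Finset.mem_univ _⟩),
    Finset.add_sum_erase _ _ (Finset.mem_univ _)]

theorem card_erase_erase {i₀ i₁ : V} (h01 : i₁ ≠ i₀) :
    (((Finset.univ.erase i₀).erase i₁).card : ℝ) = Fintype.card V - 2 := by
  have := sum_eq_add_add_sum_erase h01 fun _ ↦ 1
  simp only [Finset.sum_const, nsmul_eq_mul, mul_one, Finset.card_univ] at this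
  linarith

theorem lapEigenvalues_of_regular {k : ℕ} (hk : 0 < k) (hcard : Fintype.card V = 2 * k)
    (hreg : G.IsRegularOfDegree k) {i₀ i₁ : V} (h01 : i₁ ≠ i₀) (h₀ : G.lapEigenvalues i₀ = 0)
    (h₁ : 2 * (k : ℝ) ≤ G.lapEigenvalues i₁) :
    G.lapEigenvalues i₁ = 2 * k ∧
      ∀ i ∈ (Finset.univ.erase i₀).erase i₁, G.lapEigenvalues i = k := by
  have hs := G.sum_lapEigenvalues
  have hs2 := G.sum_lapEigenvalues_sq
  have hc := card_erase_erase h01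
  rw [sum_eq_add_add_sum_erase h01, two_mul_card_edgeFinset_of_regular hreg] at hs
  rw [sum_eq_add_add_sum_erase h01, two_mul_card_edgeFinset_of_regular hreg,
    firstZagrebIndex_of_regular hreg] at hs2
  rw [h₀] at hs hs2
  rw [hcard] at hs hs2 hc
  push_cast at hs hs2 hc
  have hk' : (0 : ℝ) < k := Nat.cast_pos.2 hk
  -- The left side is nonnegative, while `2k ≤ μ` for the eigenvalue `μ` at `i₁` makes the right
  -- side nonpositive, so both vanish.
  have hsum : ∑ i ∈ (Finset.univ.erase i₀).erase i₁, (G.lapEigenvalues i - k) ^ 2 =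
      (2 * k - G.lapEigenvalues i₁) * G.lapEigenvalues i₁ := by
    simp_rw [sub_sq, Finset.sum_add_distrib, Finset.sum_sub_distrib, Finset.sum_const,
      nsmul_eq_mul, mul_assoc, ← Finset.mul_sum, ← Finset.sum_mul]
    rw [hc]
    linear_combination hs2 - 2 * k * hs
  have h1 : G.lapEigenvalues i₁ = 2 * k := by
    have := hsum ▸ Finset.sum_nonneg fun i _ ↦ sq_nonneg (G.lapEigenvalues i - k)
    nlinarith
  refine ⟨h1, fun i hi ↦ ?_⟩
  rw [h1, sub_self, zero_mul] at hsum
  have := (Finset.sum_eq_zero_iff_of_nonneg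
    fun i _ ↦ sq_nonneg (G.lapEigenvalues i - k)).1 hsum i hi
  exact sub_eq_zero.1 (pow_eq_zero_iff two_ne_zero |>.1 this)

theorem IsBipartite.card_eq_two_mul_and_regular (h : G.IsBipartite) (h3 : 3 ≤ Fintype.card V)
    {a b : ℝ} (ha : 0 < a) (ha2 : a ^ 2 * Fintype.card V = 4 * G.firstZagrebIndex) (hab : b ≤ a)
    {i₀ i₁ : V} (h01 : i₁ ≠ i₀) (h₀ : G.lapEigenvalues i₀ = 0) (h₁ : G.lapEigenvalues i₁ = a)
    (hb : ∀ i ∈ (Finset.univ.erase i₀).erase i₁, G.lapEigenvalues i = b) :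
    ∃ k : ℕ, 0 < k ∧ Fintype.card V = 2 * k ∧ G.IsRegularOfDegree k := by
  have : Nonempty V := ⟨i₀⟩
  have hdeg := (h.exists_le_lapEigenvalues ha.le ha2).2 fun i ↦ by
    by_cases hi0 : i = i₀
    · rw [hi0, h₀]; exact ha.le
    by_cases hi1 : i = i₁
    · rw [hi1, h₁]
    · exact (hb i (by simp [hi0, hi1])).trans_le hab
  obtain ⟨k, hk⟩ : ∃ k, k = G.degree i₀ := ⟨_, rfl⟩
  have hak : a = 2 * k := by rw [hk, hdeg]
  have hreg : G.IsRegularOfDegree k := fun v ↦ by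
    have : (G.degree v : ℝ) = k := by linarith [hdeg v]
    exact_mod_cast this
  have hk0 : (0 : ℝ) < k := by linarith
  refine ⟨k, Nat.cast_pos.1 hk0, ?_, hreg⟩
  have hs := G.sum_lapEigenvalues
  have hs2 := G.sum_lapEigenvalues_sq
  rw [sum_eq_add_add_sum_erase h01, two_mul_card_edgeFinset_of_regular hreg,
    Finset.sum_congr rfl hb, Finset.sum_const, nsmul_eq_mul, card_erase_erase h01] at hs
  rw [sum_eq_add_add_sum_erase h01, two_mul_card_edgeFinset_of_regular hreg,
    firstZagrebIndex_of_regular hreg, Finset.sum_congr rfl fun i hi ↦ by rw [hb i hi],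
    Finset.sum_const, nsmul_eq_mul, card_erase_erase h01] at hs2
  rw [h₀, h₁, hak] at hs hs2
  have h3' : (3 : ℝ) ≤ Fintype.card V := by exact_mod_cast h3
  have hbk : b = k := by
    have : ((Fintype.card V : ℝ) - 2) * (b - k) = 0 := by linear_combination hs
    exact sub_eq_zero.1 ((mul_eq_zero.1 this).resolve_left (by linarith))
  rw [hbk] at hs2
  have : (k : ℝ) * (Fintype.card V - 2 * k) = 0 := by linear_combination -hs2
  have := sub_eq_zero.1 ((mul_eq_zero.1 this).resolve_left hk0.ne')
  exact_mod_cast this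

theorem IsBipartite.card_eq_two_mul_and_regular_iff (h : G.IsBipartite)
    (h3 : 3 ≤ Fintype.card V) :
    (∃ k : ℕ, 0 < k ∧ Fintype.card V = 2 * k ∧ G.IsRegularOfDegree k) ↔
      Even (Fintype.card V) ∧ Nonempty (G ≃g
        completeBipartiteGraph (Fin (Fintype.card V / 2)) (Fin (Fintype.card V / 2))) := by
  constructor
  · rintro ⟨k, hk, hcard, hreg⟩
    refine ⟨hcard ▸ even_two_mul k, ?_⟩
    rw [show Fintype.card V / 2 = k by omega]
    exact exists_iso_completeBipartiteGraph_of_regular h hcard hreg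
  · rintro ⟨heven, ⟨e⟩⟩
    exact ⟨Fintype.card V / 2, by omega, (Nat.two_mul_div_two_of_even heven).symm,
      isRegularOfDegree_of_iso_completeBipartiteGraph e⟩

end SimpleGraph

/-! ### The two bounds -/

namespace SimpleGraph

variable {V : Type*} [Fintype V] [DecidableEq V] {G : SimpleGraph V} [DecidableRel G.Adj]

theorem laplacianEstradaIndex_eq_of_lapEigenvalues_eq_zero {i₀ i₁ : V} (h01 : i₁ ≠ i₀)
    (h₀ : G.lapEigenvalues i₀ = 0) :
    G.laplacianEstradaIndex = 1 + (Real.exp (G.lapEigenvalues i₁) +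
      ∑ i ∈ (Finset.univ.erase i₀).erase i₁, Real.exp (G.lapEigenvalues i)) := by
  change ∑ i, Real.exp (G.lapEigenvalues i) = _
  rw [sum_eq_add_add_sum_erase h01, h₀, Real.exp_zero]

/-- The argument shared by both bounds. Only `hC`, the exponential-sum estimate, and `hb`, which
identifies `b` when the spectrum is extremal, depend on the constraint used. -/
theorem IsBipartite.le_laplacianEstradaIndex_and_eq_iff (h : G.IsBipartite)
    (h3 : 3 ≤ Fintype.card V) {a b : ℝ} (ha : 0 < a)
    (ha2 : a ^ 2 * Fintype.card V = 4 * G.firstZagrebIndex) (hab : b ≤ a)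
    {i₀ i₁ : V} (h01 : i₁ ≠ i₀) (h₀ : G.lapEigenvalues i₀ = 0) (h₁ : a ≤ G.lapEigenvalues i₁)
    (hC : Real.exp a + ((Finset.univ.erase i₀).erase i₁).card * Real.exp b ≤
        Real.exp (G.lapEigenvalues i₁) +
          ∑ i ∈ (Finset.univ.erase i₀).erase i₁, Real.exp (G.lapEigenvalues i) ∧
      (Real.exp (G.lapEigenvalues i₁) +
          ∑ i ∈ (Finset.univ.erase i₀).erase i₁, Real.exp (G.lapEigenvalues i) =
        Real.exp a + ((Finset.univ.erase i₀).erase i₁).card * Real.exp b →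
        G.lapEigenvalues i₁ = a ∧
          ∀ i ∈ (Finset.univ.erase i₀).erase i₁, G.lapEigenvalues i = b))
    (hb : ∀ c, 0 ≤ c → G.lapEigenvalues i₁ = a →
      (∀ i ∈ (Finset.univ.erase i₀).erase i₁, G.lapEigenvalues i = c) → b = c) :
    (1 + Real.exp a + ((Fintype.card V : ℝ) - 2) * Real.exp b ≤ G.laplacianEstradaIndex) ∧
      (G.laplacianEstradaIndex = 1 + Real.exp a + ((Fintype.card V : ℝ) - 2) * Real.exp b ↔
        Even (Fintype.card V) ∧ Nonempty (G ≃g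
          completeBipartiteGraph (Fin (Fintype.card V / 2)) (Fin (Fintype.card V / 2)))) := by
  rw [laplacianEstradaIndex_eq_of_lapEigenvalues_eq_zero h01 h₀, ← card_erase_erase h01, add_assoc,
    add_right_inj, ← h.card_eq_two_mul_and_regular_iff h3]
  refine ⟨add_le_add_right hC.1 1, fun heq ↦ ?_, fun ⟨k, hk, hcard, hreg⟩ ↦ ?_⟩
  · obtain ⟨hxa, hyb⟩ := hC.2 heq
    exact h.card_eq_two_mul_and_regular h3 ha ha2 hab h01 h₀ hxa hyb
  · have hak : a = 2 * k := by
      rw [firstZagrebIndex_of_regular hreg] at ha2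
      have hV : (Fintype.card V : ℝ) ≠ 0 := by
        rw [Nat.cast_ne_zero]; omega
      have : a ^ 2 = (2 * (k : ℝ)) ^ 2 := mul_right_cancel₀ hV (by linear_combination ha2)
      exact (pow_left_inj₀ ha.le (by positivity) two_ne_zero).1 this
    obtain ⟨hx, hy⟩ := lapEigenvalues_of_regular hk hcard hreg h01 h₀ (hak ▸ h₁)
    rw [hb k k.cast_nonneg (hx.trans hak.symm) hy, hx, hak,
      Finset.sum_congr rfl fun i hi ↦ by rw [hy i hi], Finset.sum_const, nsmul_eq_mul]

end SimpleGraph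

theorem mainTheorem10 {V : Type*} [Fintype V] [DecidableEq V] (G : SimpleGraph V)
    [DecidableRel G.Adj] (n m t : ℕ) (M₁ : ℝ)
    (hn : n = Fintype.card V) (hm : m = G.edgeFinset.card)
    (ht : t = G.numSpanningTrees) (hM₁ : M₁ = (G.firstZagrebIndex : ℝ))
    (hn3 : 3 ≤ n) (hconn : G.Connected) (hbip : G.IsBipartite) :
    (1 + Real.exp (2 * √(M₁ / n))
        + ((n : ℝ) - 2) * Real.exp ((2 * (m : ℝ) - 2 * √(M₁ / n)) / ((n : ℝ) - 2))
      ≤ G.laplacianEstradaIndex) ∧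
    (G.laplacianEstradaIndex
        = 1 + Real.exp (2 * √(M₁ / n))
          + ((n : ℝ) - 2) * Real.exp ((2 * (m : ℝ) - 2 * √(M₁ / n)) / ((n : ℝ) - 2)) ↔
      Even n ∧ Nonempty (G ≃g completeBipartiteGraph (Fin (n / 2)) (Fin (n / 2)))) ∧
    (1 + Real.exp (2 * √(M₁ / n))
        + ((n : ℝ) - 2)
          * Real.exp (((t : ℝ) * n * √(n : ℝ) / (2 * √M₁)) ^ (1 / ((n : ℝ) - 2)))
      ≤ G.laplacianEstradaIndex) ∧
    (G.laplacianEstradaIndex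
        = 1 + Real.exp (2 * √(M₁ / n))
          + ((n : ℝ) - 2)
            * Real.exp (((t : ℝ) * n * √(n : ℝ) / (2 * √M₁)) ^ (1 / ((n : ℝ) - 2))) ↔
      Even n ∧ Nonempty (G ≃g completeBipartiteGraph (Fin (n / 2)) (Fin (n / 2)))) := by
  subst hn
  have hne : Nonempty V := hconn.nonempty
  have hn3' : (3 : ℝ) ≤ Fintype.card V := by exact_mod_cast hn3
  have hn0 : (0 : ℝ) < Fintype.card V := by linarith
  have hm0 : (0 : ℝ) < m := by
    have := hconn.card_vert_le_card_edgeSet_add_one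
    rw [Nat.card_eq_fintype_card, Nat.card_eq_fintype_card, ← SimpleGraph.edgeFinset_card, ← hm]
      at this
    exact Nat.cast_pos.2 (by omega)
  have hMm : (2 * m : ℝ) ^ 2 ≤ Fintype.card V * M₁ := by
    have := sq_sum_le_card_mul_sum_sq (s := Finset.univ) (f := fun v ↦ (G.degree v : ℝ))
    rw [G.sum_degree_cast, ← hm, Finset.card_univ] at this
    rw [hM₁, SimpleGraph.firstZagrebIndex]
    push_cast
    exact this
  have hM0 : 0 < M₁ := by
    by_contra! hle
    nlinarith [mul_nonneg hn0.le (neg_nonneg.2 hle), pow_pos hm0 2]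
  obtain ⟨a, hadef⟩ : ∃ a, a = 2 * √(M₁ / Fintype.card V) := ⟨_, rfl⟩
  have ha : 0 < a := hadef ▸ mul_pos two_pos (Real.sqrt_pos.2 (div_pos hM0 hn0))
  have ha2 : a ^ 2 * Fintype.card V = 4 * M₁ := by
    rw [hadef, mul_pow, Real.sq_sqrt (div_pos hM0 hn0).le]
    field_simp
    norm_num
  have hma : 4 * m ≤ a * Fintype.card V := by
    refine (pow_le_pow_iff_left₀ (by positivity) (by positivity) two_ne_zero).1 ?_
    calc (4 * (m : ℝ)) ^ 2 = 4 * (2 * m) ^ 2 := by ring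
      _ ≤ 4 * (Fintype.card V * M₁) := by linarith
      _ = (a * Fintype.card V) ^ 2 := by linear_combination -(Fintype.card V : ℝ) * ha2
  -- Uses `n / 2 ≤ n - 1`.
  have hma' : 2 * (m : ℝ) ≤ (Fintype.card V - 1) * a := by nlinarith
  have hT : (t : ℝ) * Fintype.card V * √(Fintype.card V : ℝ) / (2 * √M₁) =
      Fintype.card V * t / a := by
    rw [hadef, Real.sqrt_div hM0.le]
    have := Real.sqrt_pos.2 hM0
    have := Real.sqrt_pos.2 hn0
    field_simp
  rw [hT, ← hadef]
  rw [hM₁] at ha2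
  obtain ⟨i₀, h₀⟩ := G.exists_lapEigenvalues_eq_zero
  obtain ⟨⟨i₁, h₁⟩, -⟩ := hbip.exists_le_lapEigenvalues ha.le ha2
  have h01 : i₁ ≠ i₀ := by
    rintro rfl
    exact (ha.trans_le h₁).ne' h₀
  have hs := G.sum_lapEigenvalues
  rw [SimpleGraph.sum_eq_add_add_sum_erase h01, h₀, zero_add, ← hm] at hs
  have hp := SimpleGraph.prod_lapEigenvalues_erase h₀
  -- AM-GM on the `n - 1` eigenvalues other than the one at `i₀` gives `n t ≤ a ^ (n - 1)`, which is
  -- what `b₂ ≤ a` requires.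
  have hle := prod_le_pow_card_of_sum_le (s := Finset.univ.erase i₀) ha
    (fun i _ ↦ G.lapEigenvalues_nonneg i) (by
      rw [← Finset.add_sum_erase _ _ (Finset.mem_erase.2 ⟨h01, Finset.mem_univ i₁⟩), hs,
        Finset.card_erase_of_mem (Finset.mem_univ _), Finset.card_univ,
        Nat.cast_sub (by omega), Nat.cast_one]
      exact hma')
  rw [hp, ← ht, ← Finset.card_erase_add_one (Finset.mem_erase.2 ⟨h01, Finset.mem_univ i₁⟩)] at hle
  rw [← Finset.mul_prod_erase _ _ (Finset.mem_erase.2 ⟨h01, Finset.mem_univ i₁⟩), ← ht] at hp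
  have hpos : ∀ i ∈ (Finset.univ.erase i₀).erase i₁, 0 < G.lapEigenvalues i := fun i hi ↦
    hconn.lapEigenvalues_pos h₀ (Finset.ne_of_mem_erase (Finset.mem_of_mem_erase hi))
  have hcard := SimpleGraph.card_erase_erase h01
  have hcard0 : ((Fintype.card V : ℝ) - 2) ≠ 0 := by linarith
  have hcardn : ((Finset.univ.erase i₀).erase i₁).card ≠ 0 := fun h ↦ by simp [h] at hcard; linarith
  have ht0 : (0 : ℝ) < t := ht ▸ Nat.cast_pos.2 hconn.numSpanningTrees_pos
  have hQ : 0 < Fintype.card V * t / a := by positivity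
  obtain ⟨b₁, hb₁⟩ : ∃ b, b = (2 * (m : ℝ) - a) / (Fintype.card V - 2) := ⟨_, rfl⟩
  obtain ⟨b₂, hb₂⟩ : ∃ b, b = (Fintype.card V * t / a) ^ (1 / ((Fintype.card V : ℝ) - 2)) :=
    ⟨_, rfl⟩
  have hb₁' : (Fintype.card V - 2) * b₁ = 2 * (m : ℝ) - a := by
    rw [hb₁, mul_div_cancel₀ _ hcard0]
  have hab₁ : b₁ ≤ a := by
    rw [hb₁, div_le_iff₀ (by linarith)]
    linarith
  have hb₂0 : 0 < b₂ := hb₂ ▸ Real.rpow_pos_of_pos hQ _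
  have hb₂' : a * b₂ ^ ((Finset.univ.erase i₀).erase i₁).card = Fintype.card V * t := by
    rw [← Real.rpow_natCast, hcard, hb₂, ← Real.rpow_mul hQ.le, one_div_mul_cancel hcard0,
      Real.rpow_one, mul_div_cancel₀ _ ha.ne']
  have hab₂ : b₂ ≤ a := by
    refine (pow_le_pow_iff_left₀ hb₂0.le ha.le hcardn).1 ?_
    refine le_of_mul_le_mul_left ?_ ha
    rwa [hb₂', ← pow_succ']
  rw [← hb₁, ← hb₂]
  have key₁ := hbip.le_laplacianEstradaIndex_and_eq_iff hn3 ha ha2 hab₁ h01 h₀ h₁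
    (exp_add_sum_exp_ge_of_sum_eq hab₁ h₁ (by rw [hs, hcard, hb₁']; ring)) fun c _ hx hy ↦ by
      rw [hx, Finset.sum_congr rfl hy, Finset.sum_const, nsmul_eq_mul, hcard] at hs
      exact mul_left_cancel₀ hcard0 (by linarith)
  have key₂ := hbip.le_laplacianEstradaIndex_and_eq_iff hn3 ha ha2 hab₂ h01 h₀ h₁
    (exp_add_sum_exp_ge_of_prod_eq hb₂0 hab₂ h₁ hpos (by rw [hp, hb₂'])) fun c hc hx hy ↦ by
      rw [hx, Finset.prod_congr rfl hy, Finset.prod_const, ← hb₂'] at hp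
      exact (pow_left_inj₀ hb₂0.le hc hcardn).1 (mul_left_cancel₀ ha.ne' hp.symm)
  exact ⟨key₁.1, key₁.2, key₂.1, key₂.2⟩
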